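/- Let $K$ be an algebraically closed field of characteristic $0$, let $P_1,\dots,P_s$ be distinct points of $\mathbb P^2_K$ and let $C_1,\dots,C_r\subset\mathbb P^2_K$ be distinct irreducible curves. Let $D$ be an effective divisor on $\mathbb P^2_K$ vanishing to order at least $m_j$ at $P_j$, i.e. $m_j\in\mathbb Z$ and $m_j\le \operatorname{mult}_{P_j}D$ for $j=1,\dots,s$ (for example $m_j=\operatorname{mult}_{P_j}D$). Consider the following reduction process. A stage consists of integers $a_1,\dots,a_r\ge 0$, a residual divisor $D'$ and integers $m'_1,\dots,m'_s$; the initial stage is $a_i=0$, $D'=D$, $m'_j=m_j$. At a given stage $C_i$ is said to violate the Bezout inequality if $$D'\cdot C_i=\deg D'\cdot\deg C_i<\sum_{j=1}^s m'_j\operatorname{mult}_{P_j}C_i .$$ A reduction step chooses a non-empty set $S$ of indices of violating curves and replaces $a_i$ by $a_i+1$ for $i\in S$, $D'$ by $D'-\sum_{i\in S}C_i$, and $m'_j$ by $m'_j-\sum_{i\in S}\operatorname{mult}_{P_j}C_i$. The process stops when no curve violates the inequality. Theorem (Uniqueness of the Bezout decomposition). 1. At every stage reachable from the initial one, $D'$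 is effective, $D=\sum_i a_iC_i+D'$, $m'_j=m_j-\sum_k a_k\operatorname{mult}_{P_j}C_k\le\operatorname{mult}_{P_j}D'$ for all $j$, and every curve $C_i$ that violates the Bezout inequality is a component of $D'$. 2. (Termination) There is no infinite sequence of reduction steps starting at the initial stage. 3. (Local confluence) If two reduction steps lead from a reachable stage $\sigma$ to stages $\tau_1$ and $\tau_2$, then some stage $\rho$ can be reached from both $\tau_1$ and $\tau_2$ by finitely many (possibly zero) reduction steps. 4. (Uniqueness) There is exactly one decomposition $$D=\sum_{i=1}^r a_iC_i+B(D)$$ that arises from a sequence of reduction steps, performed in any order, from the initial stage to a stage at which the process stops. Here $a_i\ge 0$, $B(D)$ is effective, and $$B(D)\cdot C_i\ \ge\ \sum_{j=1}^s\Bigl(m_j-\sum_{k=1}^r a_k\operatorname{mult}_{P_j}C_k\Bigr)\operatorname{mult}_{P_j}C_i\qquad (i=1,\dots,r).$$ Every sequence of reductions from the initial stage can be completed to one that stops, and then it ends with this decomposition. In particular this decomposition is the result of the algorithm which in each round subtracts all violating curves simultaneously. -/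

import Mathlib

open MvPolynomial

noncomputable section

namespace BezoutDecomposition

/-- The projective plane over `K`. -/
abbrev Plane (K : Type*) [Field K] : Type _ := Projectivization K (Fin 3 → K)

/-- The homogeneous ideal of a point `P`, generated by all forms vanishing at `P`. -/
def pointIdeal {K : Type*} [Field K] (P : Plane K) : Ideal (MvPolynomial (Fin 3) K) :=
  Ideal.span {F | (∃ d : ℕ, F.IsHomogeneous d) ∧ eval P.rep F = 0}

/-- An irreducible plane curve, given by its homogeneous ideal, which is the ideal generated by
one irreducible form. -/
@[ext]
structure PlaneCurve (K : Type*) [Field K] where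
  ideal : Ideal (MvPolynomial (Fin 3) K)
  exists_form : ∃ F : MvPolynomial (Fin 3) K,
    Irreducible F ∧ (∃ d : ℕ, F.IsHomogeneous d) ∧ ideal = Ideal.span {F}

namespace PlaneCurve

variable {K : Type*} [Field K]

/-- An equation of the curve (unique up to a nonzero scalar). -/
def form (C : PlaneCurve K) : MvPolynomial (Fin 3) K := C.exists_form.choose

theorem form_irreducible (C : PlaneCurve K) : Irreducible C.form :=
  C.exists_form.choose_spec.1

theorem form_isHomogeneous (C : PlaneCurve K) : ∃ d : ℕ, C.form.IsHomogeneous d :=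
  C.exists_form.choose_spec.2.1

theorem ideal_eq_span_form (C : PlaneCurve K) : C.ideal = Ideal.span {C.form} :=
  C.exists_form.choose_spec.2.2

/-- The degree of the curve. -/
def degree (C : PlaneCurve K) : ℕ := C.form.totalDegree

/-- The multiplicity of the curve at `P`: the largest `n` such that its equation lies in the
`n`-th power of the ideal of `P`. -/
def mult (C : PlaneCurve K) (P : Plane K) : ℕ := sSup {n : ℕ | C.form ∈ pointIdeal P ^ n}

end PlaneCurve

/-- A divisor on the projective plane: a formal integral combination of irreducible curves.
It is effective if `0 ≤ D`. -/
abbrev PlaneDivisor (K : Type*) [Field K] : Type _ := PlaneCurve K →₀ ℤ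

namespace PlaneDivisor

variable {K : Type*} [Field K]

/-- An irreducible curve as a divisor. -/
def ofCurve (C : PlaneCurve K) : PlaneDivisor K := Finsupp.single C 1

/-- The degree of a divisor. -/
def degree (D : PlaneDivisor K) : ℤ := D.sum fun C n => n * (C.degree : ℤ)

/-- The multiplicity (order of vanishing) of a divisor at a point. -/
def mult (D : PlaneDivisor K) (P : Plane K) : ℤ := D.sum fun C n => n * (C.mult P : ℤ)

/-- The intersection number of two divisors on the plane. -/
def inter (D E : PlaneDivisor K) : ℤ := degree D * degree E

end PlaneDivisor

/-- A stage of the reduction algorithm: how often each of the curves `C 0, …, C (r - 1)` has been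
removed so far, the residual divisor, and the orders of vanishing at the points
`P 0, …, P (s - 1)` with which the algorithm continues. -/
@[ext]
structure Stage (K : Type*) [Field K] (s r : ℕ) where
  coeff : Fin r → ℕ
  residual : PlaneDivisor K
  order : Fin s → ℤ

namespace Stage

variable {K : Type*} [Field K] {s r : ℕ}

/-- The initial stage: nothing has been removed. -/
def start (D : PlaneDivisor K) (m : Fin s → ℤ) : Stage K s r := ⟨0, D, m⟩

/-- The curve `C i` violates the Bezout inequality for the residual divisor `D'` with orders
`m'`: `D' · C i < ∑ j, m' j * mult_{P j} (C i)`. -/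
def Violates (P : Fin s → Plane K) (C : Fin r → PlaneCurve K) (σ : Stage K s r) (i : Fin r) :
    Prop :=
  σ.residual.inter (PlaneDivisor.ofCurve (C i)) < ∑ j, σ.order j * ((C i).mult (P j) : ℤ)

open scoped Classical in
/-- The set of all indices whose curve violates the Bezout inequality. -/
def violating (P : Fin s → Plane K) (C : Fin r → PlaneCurve K) (σ : Stage K s r) :
    Finset (Fin r) :=
  Finset.univ.filter fun i => σ.Violates P C i

/-- Subtract each of the curves `C i`, `i ∈ S`, once. -/
def remove (P : Fin s → Plane K) (C : Fin r → PlaneCurve K) (σ : Stage K s r)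
    (S : Finset (Fin r)) : Stage K s r where
  coeff i := σ.coeff i + if i ∈ S then 1 else 0
  residual := σ.residual - ∑ i ∈ S, PlaneDivisor.ofCurve (C i)
  order j := σ.order j - ∑ i ∈ S, ((C i).mult (P j) : ℤ)

/-- One reduction step, in an arbitrary order: subtract some of the violating curves, at least
one of them. -/
def Step (P : Fin s → Plane K) (C : Fin r → PlaneCurve K) (σ τ : Stage K s r) : Prop :=
  ∃ S : Finset (Fin r), S.Nonempty ∧ (∀ i ∈ S, σ.Violates P C i) ∧ τ = σ.remove P C S

/-- `τ` is obtained from `σ` by finitely many (possibly zero) reduction steps. -/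
def Reduces (P : Fin s → Plane K) (C : Fin r → PlaneCurve K) : Stage K s r → Stage K s r → Prop :=
  Relation.ReflTransGen (Step P C)

/-- No curve violates the Bezout inequality, so the algorithm stops. -/
def IsTerminal (P : Fin s → Plane K) (C : Fin r → PlaneCurve K) (σ : Stage K s r) : Prop :=
  ∀ i, ¬ σ.Violates P C i

/-- One round of the algorithm: subtract all violating curves simultaneously. -/
def round (P : Fin s → Plane K) (C : Fin r → PlaneCurve K) (σ : Stage K s r) : Stage K s r :=
  σ.remove P C (σ.violating P C)

end Stage

/-- `D = ∑ i, a i • C i + B` is an outcome of the reduction algorithm, the reductions being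
performed in some order until no curve violates the Bezout inequality. -/
def IsBezoutDecomposition {K : Type*} [Field K] {s r : ℕ} (P : Fin s → Plane K)
    (C : Fin r → PlaneCurve K) (D : PlaneDivisor K) (m : Fin s → ℤ)
    (a : Fin r → ℕ) (B : PlaneDivisor K) : Prop :=
  ∃ σ : Stage K s r, Stage.Reduces P C (Stage.start D m) σ ∧ σ.IsTerminal P C ∧
    σ.coeff = a ∧ σ.residual = B

end BezoutDecomposition

end

/-!
The geometric input is Bezout's inequality: two distinct irreducible curves `C`, `E` and distinct
points `P j` satisfy `∑ j, mult_{P j} C * mult_{P j} E ≤ deg C * deg E`.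

It is obtained by counting dimensions, without local intersection numbers. Dehomogenization at a
point (`chart`) sends powers of the ideal of the point into powers of the maximal ideal of the
origin of an affine plane. In degree `N ≥ ∑ j, k j`, vanishing to order `k j` at `P j` imposes
exactly `∑ j, k j * (k j + 1) / 2` independent conditions on forms
(`two_mul_finrank_formsVanishing`), because forms can be found with prescribed jets at all the
points (`jets_surjective`). Now let `F` and `G` be coprime forms of degrees `d` and `e` with orders
`m j` and `n j`. Multiplying `F` by forms with orders `n j`, and `G` by forms with orders `m j`,
gives two spaces of forms with orders `m j + n j`, in a common large degree. They meet in multiples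
of `F * G` only, and the dimension formula for the sum and the intersection of the two spaces
becomes `∑ j, m j * n j ≤ d * e` (`sum_mul_le_of_not_dvd`).

The statements on the reduction process follow. If `C i` is not a component of the effective
residual divisor, then Bezout's inequality prevents a violation
(`Stage.Violates.one_le_residual`); so residual divisors stay effective, and the number of copies
of the `C i` left in them strictly decreases, which gives termination. If `C i` violates the
inequality and other curves are removed, then again by Bezout's inequality the left hand side drops
at least as much as the right hand side, so that `C i` still violates it
(`Stage.Violates.remove`). Hence the steps removing `S` and `T` can both be continued to the removal
of `S ∪ T` (`Stage.step_diamond`), and the Church-Rosser theorem yields uniqueness of the outcome.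
-/

noncomputable section

namespace BezoutDecomposition

variable {K : Type*} [Field K]

/-! ### Dehomogenization at a point -/

theorem Plane.exists_rep_ne_zero (P : Plane K) : ∃ i, P.rep i ≠ 0 :=
  Function.ne_iff.mp P.rep_nonzero

/-- A coordinate that does not vanish at `P`. -/
def Plane.pivot (P : Plane K) : Fin 3 := P.exists_rep_ne_zero.choose

theorem Plane.rep_pivot_ne_zero (P : Plane K) : P.rep P.pivot ≠ 0 :=
  P.exists_rep_ne_zero.choose_spec

/-- Dehomogenization at `P`: the pivot coordinate is fixed at its value at `P`, and the other two
coordinates are expanded around their values at `P`. -/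
def chart (P : Plane K) : MvPolynomial (Fin 3) K →ₐ[K] MvPolynomial (Fin 2) K :=
  aeval (P.pivot.insertNth (C (P.rep P.pivot))
    (fun i => C (P.rep (P.pivot.succAbove i)) + X i))

theorem chart_X_pivot (P : Plane K) : chart P (X P.pivot) = C (P.rep P.pivot) := by
  simp [chart]

theorem chart_X_succAbove (P : Plane K) (i : Fin 2) :
    chart P (X (P.pivot.succAbove i)) = C (P.rep (P.pivot.succAbove i)) + X i := by
  simp [chart]

theorem constantCoeff_chart (P : Plane K) (F : MvPolynomial (Fin 3) K) :
    constantCoeff (chart P F) = eval P.rep F := by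
  have h : (constantCoeff.comp (chart P : MvPolynomial (Fin 3) K →+* MvPolynomial (Fin 2) K)) =
      eval P.rep := by
    refine MvPolynomial.ringHom_ext (fun r => by simp [chart]) fun i => ?_
    rcases Fin.eq_self_or_eq_succAbove P.pivot i with rfl | ⟨k, rfl⟩
    · simp [chart_X_pivot]
    · simp [chart_X_succAbove]
  exact congrArg (fun φ => φ F) h

theorem mem_idealOfVars_iff_constantCoeff {σ : Type*} (f : MvPolynomial σ K) :
    f ∈ idealOfVars σ K ↔ constantCoeff f = 0 := by
  rw [← pow_one (idealOfVars σ K), mem_pow_idealOfVars_iff', constantCoeff_eq]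
  simp [Finsupp.degree_eq_zero_iff]

/-- Only this inclusion is needed: vanishing in the sense of `pointIdeal` implies vanishing of the
same order in the chart. -/
theorem chart_mem_pow (P : Plane K) {n : ℕ} {F : MvPolynomial (Fin 3) K}
    (hF : F ∈ pointIdeal P ^ n) : chart P F ∈ idealOfVars (Fin 2) K ^ n := by
  have h : (pointIdeal P).map (chart P) ≤ idealOfVars (Fin 2) K := by
    rw [pointIdeal, Ideal.map_span, Ideal.span_le]
    rintro _ ⟨F, ⟨-, hF⟩, rfl⟩
    exact (mem_idealOfVars_iff_constantCoeff _).2 ((constantCoeff_chart P F).trans hF)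
  have h' := Ideal.mem_map_of_mem (chart P) hF
  rw [Ideal.map_pow] at h'
  exact Ideal.pow_right_mono h n h'

/-- The homogeneous ideal of a point lies in the irrelevant ideal. This bounds the powers of
`pointIdeal P` that contain a given nonzero form. -/
theorem pointIdeal_le_idealOfVars (P : Plane K) : pointIdeal P ≤ idealOfVars (Fin 3) K := by
  rw [pointIdeal, Ideal.span_le]
  rintro F ⟨⟨d, hd⟩, hF⟩
  refine (mem_idealOfVars_iff_constantCoeff _).2 ?_
  rcases Nat.eq_zero_or_pos d with rfl | hpos
  · have := (totalDegree_zero_iff_isHomogeneous (Fin 3)).2 hd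
    rw [totalDegree_eq_zero_iff_eq_C] at this
    rw [this] at hF ⊢
    simpa using hF
  · rw [constantCoeff_eq]
    exact hd.coeff_eq_zero (by simpa using hpos.ne)

/-- The supremum that defines the multiplicity is attained. -/
theorem PlaneCurve.form_mem_pow_mult (C : PlaneCurve K) (P : Plane K) :
    C.form ∈ pointIdeal P ^ C.mult P := by
  refine Nat.sSup_mem (s := {n : ℕ | C.form ∈ pointIdeal P ^ n}) ⟨0, by simp⟩
    ⟨C.form.totalDegree, fun n hn => ?_⟩
  have h := Ideal.pow_right_mono (pointIdeal_le_idealOfVars P) n hn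
  rw [mem_pow_idealOfVars_iff] at h
  obtain ⟨d, hd⟩ := support_nonempty.2 C.form_irreducible.ne_zero
  exact (h d hd).trans (le_totalDegree hd)

/-- In the chart at `P`, every polynomial of degree at most `M` is the dehomogenization of a form
of degree `M`. -/
theorem exists_form_chart_eq (P : Plane K) (f : MvPolynomial (Fin 2) K) {M : ℕ}
    (hf : f.totalDegree ≤ M) : ∃ F : MvPolynomial (Fin 3) K, F.IsHomogeneous M ∧ chart P F = f := by
  set c := P.rep P.pivot with hc
  have hc0 : c ≠ 0 := P.rep_pivot_ne_zero
  -- forms that become `1`, `X 0` and `X 1` in the chart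
  let l : MvPolynomial (Fin 3) K := C c⁻¹ * X P.pivot
  let v : Fin 2 → MvPolynomial (Fin 3) K := fun i =>
    X (P.pivot.succAbove i) - C (P.rep (P.pivot.succAbove i)) * l
  have hl : l.IsHomogeneous 1 := isHomogeneous_C_mul_X _ _
  have hv : ∀ i, (v i).IsHomogeneous 1 := fun i => (isHomogeneous_X _ _).sub (hl.C_mul _)
  have hcl : chart P l = 1 := by
    rw [map_mul, chart_X_pivot, algHom_C, algebraMap_eq, ← C_mul, inv_mul_cancel₀ hc0, C_1]
  have hcv : ∀ i, chart P (v i) = X i := fun i => by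
    rw [map_sub, map_mul, hcl, algHom_C, algebraMap_eq, chart_X_succAbove]
    ring
  refine ⟨∑ d ∈ f.support, C (f.coeff d) * (l ^ (M - d.degree) * ∏ i, v i ^ d i), ?_, ?_⟩
  · refine IsHomogeneous.sum _ _ _ fun d hd => IsHomogeneous.C_mul ?_ _
    have h1 := hl.pow (M - d.degree)
    have h2 : (∏ i, v i ^ d i).IsHomogeneous (∑ i, 1 * d i) :=
      IsHomogeneous.prod _ _ _ fun i _ => (hv i).pow (d i)
    have h3 : d.degree ≤ M := (le_totalDegree hd).trans hf
    convert h1.mul h2 using 1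
    simp only [one_mul]
    rw [← Finsupp.degree_eq_sum]
    omega
  · conv_rhs => rw [f.as_sum]
    simp only [map_sum, map_mul, map_pow, map_prod, hcl, hcv, one_pow, one_mul, algHom_C,
      algebraMap_eq]
    refine Finset.sum_congr rfl fun d _ => ?_
    rw [monomial_eq, Finsupp.prod_fintype _ _ (by simp)]

/-! ### Jets at the origin -/

/-- The exponents of the monomials in two variables of degree less than `k`. -/
def jetIndex (k : ℕ) : Finset (Fin 2 →₀ ℕ) :=
  (Finset.range k).biUnion fun n => Finset.finsuppAntidiag Finset.univ n

theorem mem_jetIndex {k : ℕ} {d : Fin 2 →₀ ℕ} : d ∈ jetIndex k ↔ d.degree < k := by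
  simp [jetIndex, Finset.mem_finsuppAntidiag, Finsupp.degree_eq_sum]

theorem two_mul_card_jetIndex (k : ℕ) : 2 * (jetIndex k).card = k * (k + 1) := by
  rw [jetIndex, Finset.card_biUnion]
  · have h : ∀ n, (Finset.finsuppAntidiag (Finset.univ : Finset (Fin 2)) n).card = n + 1 := by
      intro n
      rw [Finset.card_finsuppAntidiag_nat_eq_choose]
      · simp [Nat.add_comm 1 n]
    simp only [h]
    induction k with
    | zero => simp
    | succ k ih => rw [Finset.sum_range_succ, mul_add, ih]; ring
  · intro a _ b _ hab
    rw [Function.onFun, Finset.disjoint_left]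
    intro d hd hd'
    rw [Finset.mem_finsuppAntidiag] at hd hd'
    exact hab (hd.1.symm.trans hd'.1)

/-- The Taylor coefficients of a polynomial at the origin, of degree less than `k`. -/
def jet (k : ℕ) : MvPolynomial (Fin 2) K →ₗ[K] (jetIndex k → K) :=
  LinearMap.pi fun d => lcoeff K d.1

theorem jet_eq_zero_iff {k : ℕ} {f : MvPolynomial (Fin 2) K} :
    jet k f = 0 ↔ f ∈ idealOfVars (Fin 2) K ^ k := by
  rw [mem_pow_idealOfVars_iff', funext_iff]
  simp [jet, mem_jetIndex]

theorem exists_form_jet_chart_eq (P : Plane K) {k M : ℕ} (hM : k ≤ M) (a : jetIndex k → K) :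
    ∃ F : MvPolynomial (Fin 3) K, F.IsHomogeneous M ∧ jet k (chart P F) = a := by
  classical
  obtain ⟨F, hF, h⟩ := exists_form_chart_eq P (∑ d, monomial d.1 (a d)) (M := M) <| by
    refine totalDegree_finsetSum_le fun d _ => (totalDegree_monomial_le _ _).trans ?_
    have := mem_jetIndex.1 d.2
    exact (this.trans_le hM).le
  refine ⟨F, hF, ?_⟩
  ext d
  simp [h, jet, coeff_monomial]

/-- A polynomial with nonzero constant term is invertible modulo every power of the maximal ideal
of the origin. -/
theorem exists_mul_sub_one_mem_pow {f : MvPolynomial (Fin 2) K} (hf : constantCoeff f ≠ 0)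
    (k : ℕ) : ∃ g, f * g - 1 ∈ idealOfVars (Fin 2) K ^ k := by
  set c := constantCoeff f
  obtain ⟨g, hg⟩ := one_sub_dvd_one_sub_pow (1 - C c⁻¹ * f) k
  refine ⟨C c⁻¹ * g, ?_⟩
  have h : f * (C c⁻¹ * g) - 1 = -(1 - C c⁻¹ * f) ^ k := by
    linear_combination -hg
  rw [h]
  refine neg_mem (Ideal.pow_mem_pow ?_ k)
  rw [mem_idealOfVars_iff_constantCoeff]
  simp only [map_sub, map_mul, map_one, constantCoeff_C]
  simp [c, hf]

/-! ### Interpolation of jets by forms -/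

theorem exists_linear_form_separating {P Q : Plane K} (h : P ≠ Q) :
    ∃ l : MvPolynomial (Fin 3) K, l.IsHomogeneous 1 ∧ eval P.rep l = 0 ∧ eval Q.rep l ≠ 0 := by
  have hQ : Q.rep ∉ Submodule.span K {P.rep} := by
    intro hQ
    obtain ⟨a, ha⟩ := Submodule.mem_span_singleton.1 hQ
    have ha0 : a ≠ 0 := by
      rintro rfl
      exact Q.rep_nonzero (by simpa using ha.symm)
    refine h ?_
    rw [← P.mk_rep, ← Q.mk_rep, Projectivization.mk_eq_mk_iff']
    exact ⟨a⁻¹, by rw [← ha, smul_smul, inv_mul_cancel₀ ha0, one_smul]⟩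
  obtain ⟨f, hf, hle⟩ := Submodule.exists_le_ker_of_notMem hQ
  have key : ∀ x, eval x (∑ i, C (f (fun j => if i = j then 1 else 0)) * X i) = f x := by
    intro x
    rw [LinearMap.pi_apply_eq_sum_univ f x]
    simp [mul_comm]
  refine ⟨∑ i, C (f (fun j => if i = j then 1 else 0)) * X i,
    IsHomogeneous.sum _ _ _ fun i _ => isHomogeneous_C_mul_X _ _, ?_, ?_⟩
  · rw [key]
    exact hle (Submodule.mem_span_singleton_self _)
  · rwa [key]

/-- A form that vanishes to order `k i` at the points `P i`, `i ≠ j`, but not at `P j`: a product of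
powers of linear forms. -/
theorem exists_form_isolating {s : ℕ} {P : Fin s → Plane K} (hP : Function.Injective P)
    (k : Fin s → ℕ) (j : Fin s) :
    ∃ H : MvPolynomial (Fin 3) K, H.IsHomogeneous (∑ i ∈ Finset.univ.erase j, k i) ∧
      (∀ i ≠ j, chart (P i) H ∈ idealOfVars (Fin 2) K ^ k i) ∧
      constantCoeff (chart (P j) H) ≠ 0 := by
  have hl : ∀ i, ∃ l : MvPolynomial (Fin 3) K, i ≠ j →
      l.IsHomogeneous 1 ∧ eval (P i).rep l = 0 ∧ eval (P j).rep l ≠ 0 := by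
    intro i
    by_cases h : i = j
    · exact ⟨0, fun h' => absurd h h'⟩
    · obtain ⟨l, hl⟩ := exists_linear_form_separating (hP.ne h)
      exact ⟨l, fun _ => hl⟩
  choose l hl using hl
  refine ⟨∏ i ∈ Finset.univ.erase j, l i ^ k i, ?_, fun i hi => ?_, ?_⟩
  · refine IsHomogeneous.prod _ _ _ fun i hi => ?_
    simpa using (hl i (Finset.ne_of_mem_erase hi)).1.pow (k i)
  · rw [← Finset.mul_prod_erase _ _ (Finset.mem_erase.2 ⟨hi, Finset.mem_univ i⟩), map_mul, map_pow]
    refine Ideal.mul_mem_right _ _ (Ideal.pow_mem_pow ?_ _)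
    rw [mem_idealOfVars_iff_constantCoeff, constantCoeff_chart]
    exact (hl i hi).2.1
  · rw [constantCoeff_chart, map_prod]
    refine Finset.prod_ne_zero_iff.2 fun i hi => ?_
    rw [map_pow]
    exact pow_ne_zero _ (hl i (Finset.ne_of_mem_erase hi)).2.2

/-- The jets of orders `k j` at the points `P j`, in the charts at these points. -/
def jets {s : ℕ} (P : Fin s → Plane K) (k : Fin s → ℕ) :
    MvPolynomial (Fin 3) K →ₗ[K] (Π j, jetIndex (k j) → K) :=
  LinearMap.pi fun j => (jet (k j)).comp (chart (P j)).toLinearMap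

theorem jets_eq_zero_iff {s : ℕ} {P : Fin s → Plane K} {k : Fin s → ℕ}
    {F : MvPolynomial (Fin 3) K} :
    jets P k F = 0 ↔ ∀ j, chart (P j) F ∈ idealOfVars (Fin 2) K ^ k j := by
  simp only [funext_iff (f := jets P k F), ← jet_eq_zero_iff]
  rfl

/-- Forms of degree `N` take arbitrary jets at distinct points, as soon as `N` is large: correct
the forms of `exists_form_isolating` by forms that interpolate at one point, and add them up. -/
theorem jets_surjective {s : ℕ} {P : Fin s → Plane K} (hP : Function.Injective P)
    (k : Fin s → ℕ) {N : ℕ} (hN : ∑ j, k j ≤ N) (a : Π j, jetIndex (k j) → K) :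
    ∃ F : MvPolynomial (Fin 3) K, F.IsHomogeneous N ∧ jets P k F = a := by
  classical
  choose H hHdeg hHmem hHconst using exists_form_isolating hP k
  choose u hu using fun j => exists_mul_sub_one_mem_pow (hHconst j) (k j)
  have hsum : ∀ j, ∑ i ∈ Finset.univ.erase j, k i + k j = ∑ i, k i := fun j =>
    Finset.sum_erase_add _ _ (Finset.mem_univ j)
  -- `A j` merely realizes `a j` as a jet; its degree plays no role
  choose A _ hA' using fun j => exists_form_jet_chart_eq (P j) (le_refl (k j)) (a j)
  -- `Q j` has the jet of `A j / H j` at `P j`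
  choose Q hQ hQ' using fun j => exists_form_jet_chart_eq (P j)
    (M := N - ∑ i ∈ Finset.univ.erase j, k i) (k := k j) (by have := hsum j; omega)
    (jet (k j) (u j * chart (P j) (A j)))
  refine ⟨∑ i, H i * Q i, IsHomogeneous.sum _ _ _ fun i _ => ?_, ?_⟩
  · convert (hHdeg i).mul (hQ i) using 1
    have := hsum i
    omega
  · funext j
    change jet (k j) (chart (P j) (∑ i, H i * Q i)) = a j
    rw [← hA' j, ← sub_eq_zero, ← map_sub, jet_eq_zero_iff, map_sum,
      ← Finset.add_sum_erase _ _ (Finset.mem_univ j), add_sub_right_comm]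
    refine add_mem ?_ (Ideal.sum_mem _ fun i hi => ?_)
    · have h1 : chart (P j) (Q j) - u j * chart (P j) (A j) ∈ idealOfVars (Fin 2) K ^ k j := by
        rw [← jet_eq_zero_iff, map_sub, hQ' j, sub_self]
      have h2 := add_mem (Ideal.mul_mem_left _ (chart (P j) (H j)) h1)
        (Ideal.mul_mem_left _ (chart (P j) (A j)) (hu j))
      convert h2 using 1
      rw [map_mul]
      ring
    · rw [map_mul]
      exact Ideal.mul_mem_right _ _ (hHmem i j (Finset.ne_of_mem_erase hi).symm)

/-! ### Dimensions of spaces of forms -/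

theorem two_mul_finrank_homogeneousSubmodule (N : ℕ) :
    2 * Module.finrank K (homogeneousSubmodule (Fin 3) K N) = (N + 1) * (N + 2) := by
  have h : {d : Fin 3 →₀ ℕ | d.degree = N} =
      (Finset.finsuppAntidiag (Finset.univ : Finset (Fin 3)) N : Set (Fin 3 →₀ ℕ)) := by
    ext d
    simp [Finset.mem_finsuppAntidiag, Finsupp.degree_eq_sum]
  have h1 : Module.finrank K (homogeneousSubmodule (Fin 3) K N) =
      (Finset.finsuppAntidiag (Finset.univ : Finset (Fin 3)) N).card := by
    rw [homogeneousSubmodule_eq_finsupp_supported, h]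
    have e := AddMonoidAlgebra.supportedEquivFinsupp (R := K) (S := K)
      (Finset.finsuppAntidiag (Finset.univ : Finset (Fin 3)) N : Set (Fin 3 →₀ ℕ))
    rw [e.finrank_eq, Module.finrank_finsupp_self]
    simp
  rw [h1, Finset.card_finsuppAntidiag_nat_eq_choose]
  have h2 : (Finset.univ : Finset (Fin 3)).card + N - 1 = N + 2 := by simp; omega
  have h3 : (N + 2).choose N = (N + 2).choose 2 := by
    rw [← Nat.choose_symm_of_eq_add (n := N + 2) (a := N) (b := 2) rfl]
  rw [h2, h3, Nat.choose_two_right, Nat.mul_div_cancel' (Nat.even_mul_pred_self _).two_dvd]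
  simp [mul_comm]

instance (N : ℕ) : FiniteDimensional K (homogeneousSubmodule (Fin 3) K N) :=
  FiniteDimensional.of_finrank_pos (by
    have := two_mul_finrank_homogeneousSubmodule (K := K) N
    have : 0 < (N + 1) * (N + 2) := by positivity
    omega)

/-- The forms of degree `N` that vanish to order at least `k j` at `P j`. -/
def formsVanishing {s : ℕ} (P : Fin s → Plane K) (k : Fin s → ℕ) (N : ℕ) :
    Submodule K (MvPolynomial (Fin 3) K) :=
  homogeneousSubmodule (Fin 3) K N ⊓ LinearMap.ker (jets P k)

theorem mem_formsVanishing {s : ℕ} {P : Fin s → Plane K} {k : Fin s → ℕ} {N : ℕ}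
    {F : MvPolynomial (Fin 3) K} : F ∈ formsVanishing P k N ↔
      F.IsHomogeneous N ∧ ∀ j, chart (P j) F ∈ idealOfVars (Fin 2) K ^ k j := by
  simp [formsVanishing, jets_eq_zero_iff]

instance {s : ℕ} (P : Fin s → Plane K) (k : Fin s → ℕ) (N : ℕ) :
    FiniteDimensional K (formsVanishing P k N) :=
  Submodule.finiteDimensional_inf_left _ _

/-- In large degree, vanishing to given orders at distinct points imposes independent
conditions. -/
theorem two_mul_finrank_formsVanishing {s : ℕ} {P : Fin s → Plane K} (hP : Function.Injective P)
    (k : Fin s → ℕ) {N : ℕ} (hN : ∑ j, k j ≤ N) :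
    2 * Module.finrank K (formsVanishing P k N) + ∑ j, k j * (k j + 1) = (N + 1) * (N + 2) := by
  set V := homogeneousSubmodule (Fin 3) K N with hV
  let f := (jets P k).domRestrict V
  have hf : LinearMap.range f = ⊤ := by
    refine LinearMap.range_eq_top.2 fun a => ?_
    obtain ⟨F, hF, h⟩ := jets_surjective hP k hN a
    exact ⟨⟨F, hF⟩, h⟩
  have hker : (LinearMap.ker f).map V.subtype = formsVanishing P k N := by
    rw [LinearMap.ker_domRestrict, Submodule.map_comap_subtype]
    rfl
  have h1 := LinearMap.finrank_range_add_finrank_ker f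
  rw [hf, finrank_top, Module.finrank_pi_fintype, ← Submodule.finrank_map_subtype_eq, hker] at h1
  simp only [Module.finrank_fintype_fun_eq_card, Fintype.card_coe] at h1
  rw [← two_mul_finrank_homogeneousSubmodule (K := K) N, ← hV, ← h1, mul_add, Finset.mul_sum]
  simp only [two_mul_card_jetIndex]
  ring

/-! ### Bezout's inequality -/

theorem finrank_map_mulLeft {F : MvPolynomial (Fin 3) K} (hF : F ≠ 0)
    (W : Submodule K (MvPolynomial (Fin 3) K)) :
    Module.finrank K (W.map (LinearMap.mulLeft K F)) = Module.finrank K W :=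
  (W.equivMapOfInjective _ (mul_right_injective₀ hF)).finrank_eq.symm

theorem isHomogeneous_of_mul_left {σ : Type*} {F B : MvPolynomial σ K} {d M : ℕ}
    (hF0 : F ≠ 0) (hF : F.IsHomogeneous d) (h : (F * B).IsHomogeneous (d + M)) :
    B.IsHomogeneous M := by
  let := MvPolynomial.gradedAlgebra (σ := σ) (R := K)
  have h1 := DirectSum.coe_decompose_mul_add_of_left_mem (homogeneousSubmodule σ K)
    (a := F) (b := B) (i := d) (j := M) hF
  rw [DirectSum.decompose_of_mem_same _ h] at h1
  rw [mul_left_cancel₀ hF0 h1]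
  exact SetLike.coe_mem (DirectSum.decompose (homogeneousSubmodule σ K) B M)

/-- Bezout's inequality for two coprime forms with orders of vanishing `m j` and `n j` at distinct
points. -/
theorem sum_mul_le_of_not_dvd {s : ℕ} {P : Fin s → Plane K} (hP : Function.Injective P)
    {F G : MvPolynomial (Fin 3) K} (hFp : Prime F) (hFG : ¬ F ∣ G) (hG0 : G ≠ 0) {d e : ℕ}
    {m n : Fin s → ℕ}
    (hF : F ∈ formsVanishing P m d) (hG : G ∈ formsVanishing P n e) :
    ∑ j, m j * n j ≤ d * e := by
  -- large enough for all three spaces of forms to have the expected dimension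
  set t := ∑ j, m j + ∑ j, n j with ht
  set S := (formsVanishing P n (t + e)).map (LinearMap.mulLeft K F) with hS
  set T := (formsVanishing P m (t + d)).map (LinearMap.mulLeft K G) with hT
  have hm := two_mul_finrank_formsVanishing hP m (N := t + d) (by omega)
  have hn := two_mul_finrank_formsVanishing hP n (N := t + e) (by omega)
  have hmn := two_mul_finrank_formsVanishing hP (m + n) (N := t + d + e)
    (by simp [Finset.sum_add_distrib]; omega)
  have ht' := two_mul_finrank_homogeneousSubmodule (K := K) t
  rw [← finrank_map_mulLeft hG0, ← hT] at hm
  rw [← finrank_map_mulLeft hFp.ne_zero, ← hS] at hn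
  rw [mem_formsVanishing] at hF hG
  have hsup : S ⊔ T ≤ formsVanishing P (m + n) (t + d + e) := by
    refine sup_le ?_ ?_
    · rintro _ ⟨A, hA, rfl⟩
      rw [SetLike.mem_coe, mem_formsVanishing] at hA
      rw [mem_formsVanishing]
      refine ⟨?_, fun j => ?_⟩
      · rw [LinearMap.mulLeft_apply, show t + d + e = d + (t + e) by omega]
        exact hF.1.mul hA.1
      · rw [LinearMap.mulLeft_apply, map_mul, Pi.add_apply, pow_add]
        exact Ideal.mul_mem_mul (hF.2 j) (hA.2 j)
    · rintro _ ⟨A, hA, rfl⟩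
      rw [SetLike.mem_coe, mem_formsVanishing] at hA
      rw [mem_formsVanishing]
      refine ⟨?_, fun j => ?_⟩
      · rw [LinearMap.mulLeft_apply, show t + d + e = e + (t + d) by omega]
        exact hG.1.mul hA.1
      · rw [LinearMap.mulLeft_apply, map_mul, mul_comm, Pi.add_apply, pow_add]
        exact Ideal.mul_mem_mul (hA.2 j) (hG.2 j)
  have hinf : S ⊓ T ≤ (homogeneousSubmodule (Fin 3) K t).map (LinearMap.mulLeft K (F * G)) := by
    rintro _ ⟨⟨A, hA, rfl⟩, ⟨B, hB, hAB⟩⟩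
    rw [SetLike.mem_coe, mem_formsVanishing] at hB
    simp only [LinearMap.mulLeft_apply] at hAB
    obtain ⟨Q, hQ⟩ := (hFp.dvd_or_dvd ⟨A, hAB⟩).resolve_left hFG
    refine ⟨Q, ?_, ?_⟩
    · exact isHomogeneous_of_mul_left hFp.ne_zero hF.1 (by rw [← hQ, add_comm]; exact hB.1)
    · simp only [LinearMap.mulLeft_apply]
      rw [← hAB, hQ]
      ring
  have hsup' := Submodule.finrank_mono hsup
  have hinf' := Submodule.finrank_mono hinf
  rw [finrank_map_mulLeft (mul_ne_zero hFp.ne_zero hG0)] at hinf'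
  have hdim := Submodule.finrank_sup_add_finrank_inf_eq S T
  have hsq : ∑ j, (m + n) j * ((m + n) j + 1) =
      ∑ j, m j * (m j + 1) + ∑ j, n j * (n j + 1) + 2 * ∑ j, m j * n j := by
    rw [Finset.mul_sum, ← Finset.sum_add_distrib, ← Finset.sum_add_distrib]
    exact Finset.sum_congr rfl fun j _ => by simp only [Pi.add_apply]; ring
  have hnum : (t + d + e + 1) * (t + d + e + 2) + (t + 1) * (t + 2) =
      (t + d + 1) * (t + d + 2) + (t + e + 1) * (t + e + 2) + 2 * (d * e) := by ring
  omega

/-- Bezout's inequality for two distinct irreducible curves. -/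
theorem PlaneCurve.bezout_inequality {s : ℕ} {P : Fin s → Plane K} (hP : Function.Injective P)
    {C E : PlaneCurve K} (h : C ≠ E) :
    ∑ j, C.mult (P j) * E.mult (P j) ≤ C.degree * E.degree := by
  have hmem : ∀ C : PlaneCurve K,
      C.form ∈ formsVanishing P (fun j => C.mult (P j)) C.degree := fun C => by
    rw [mem_formsVanishing]
    obtain ⟨d, hd⟩ := C.form_isHomogeneous
    refine ⟨?_, fun j => chart_mem_pow _ (C.form_mem_pow_mult _)⟩
    rwa [PlaneCurve.degree, hd.totalDegree C.form_irreducible.ne_zero]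
  refine sum_mul_le_of_not_dvd hP C.form_irreducible.prime (fun hdvd => h ?_)
    E.form_irreducible.ne_zero (hmem C) (hmem E)
  ext1
  rw [C.ideal_eq_span_form, E.ideal_eq_span_form, Ideal.span_singleton_eq_span_singleton]
  exact C.form_irreducible.associated_of_dvd E.form_irreducible hdvd

/-! ### Divisors -/

namespace PlaneDivisor

theorem degree_ofCurve (C : PlaneCurve K) : degree (ofCurve C) = C.degree := by
  simp [degree, ofCurve]

theorem mult_ofCurve (C : PlaneCurve K) (P : Plane K) : mult (ofCurve C) P = C.mult P := by
  simp [mult, ofCurve]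

theorem degree_sub (D E : PlaneDivisor K) : degree (D - E) = degree D - degree E :=
  Finsupp.sum_sub_index fun _ _ _ => sub_mul _ _ _

theorem mult_sub (D E : PlaneDivisor K) (P : Plane K) : mult (D - E) P = mult D P - mult E P :=
  Finsupp.sum_sub_index fun _ _ _ => sub_mul _ _ _

theorem degree_finsetSum {ι : Type*} (S : Finset ι) (D : ι → PlaneDivisor K) :
    degree (∑ i ∈ S, D i) = ∑ i ∈ S, degree (D i) :=
  (Finsupp.sum_finsetSum_index (fun _ => zero_mul _) fun _ _ _ => add_mul _ _ _).symm

theorem mult_finsetSum {ι : Type*} (S : Finset ι) (D : ι → PlaneDivisor K) (P : Plane K) :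
    mult (∑ i ∈ S, D i) P = ∑ i ∈ S, mult (D i) P :=
  (Finsupp.sum_finsetSum_index (fun _ => zero_mul _) fun _ _ _ => add_mul _ _ _).symm

theorem sum_ofCurve_apply {r : ℕ} {C : Fin r → PlaneCurve K} (hC : Function.Injective C)
    (S : Finset (Fin r)) (k : Fin r) :
    (∑ i ∈ S, ofCurve (C i)) (C k) = if k ∈ S then 1 else 0 := by
  classical
  simp [ofCurve, Finsupp.finsetSum_apply, Finsupp.single_apply, hC.eq_iff]

theorem sum_ofCurve_apply_of_ne {r : ℕ} {C : Fin r → PlaneCurve K} (S : Finset (Fin r))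
    {E : PlaneCurve K} (hE : ∀ i, C i ≠ E) : (∑ i ∈ S, ofCurve (C i)) E = 0 := by
  classical
  simp [ofCurve, Finsupp.finsetSum_apply, hE]

/-- Bezout's inequality for an effective divisor and a curve that is not one of its components. -/
theorem bezout_inequality {s : ℕ} {P : Fin s → Plane K} (hP : Function.Injective P)
    {D : PlaneDivisor K} (hD : 0 ≤ D) {C : PlaneCurve K} (hC : D C = 0) :
    ∑ j, D.mult (P j) * (C.mult (P j) : ℤ) ≤ D.inter (ofCurve C) := by
  rw [inter, degree_ofCurve]
  simp only [mult, degree, Finsupp.sum, Finset.sum_mul]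
  rw [Finset.sum_comm]
  refine Finset.sum_le_sum fun E hE => ?_
  have hEC : E ≠ C := by
    rintro rfl
    exact Finsupp.mem_support_iff.1 hE hC
  have h : ∑ j, (E.mult (P j) : ℤ) * C.mult (P j) ≤ E.degree * C.degree := by
    exact_mod_cast PlaneCurve.bezout_inequality hP hEC
  simp only [mul_assoc, ← Finset.mul_sum]
  exact mul_le_mul_of_nonneg_left h (hD E)

end PlaneDivisor

/-! ### The reduction process -/

open PlaneDivisor

namespace Stage

variable {s r : ℕ} {P : Fin s → Plane K} {C : Fin r → PlaneCurve K}

/-- The stages that the reduction process can meet: decompositions of the effective divisor `D`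
together with the orders of vanishing that remain of `m`. -/
structure IsAdmissible (P : Fin s → Plane K) (C : Fin r → PlaneCurve K) (D : PlaneDivisor K)
    (m : Fin s → ℤ) (σ : Stage K s r) : Prop where
  effective : 0 ≤ σ.residual
  decomposition : D = ∑ i, σ.coeff i • ofCurve (C i) + σ.residual
  order_eq : ∀ j, σ.order j = m j - ∑ k, (σ.coeff k : ℤ) * ((C k).mult (P j) : ℤ)
  order_le : ∀ j, σ.order j ≤ σ.residual.mult (P j)

theorem isAdmissible_start {D : PlaneDivisor K} (hD : 0 ≤ D) {m : Fin s → ℤ}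
    (hm : ∀ j, m j ≤ D.mult (P j)) : IsAdmissible P C D m (start D m) where
  effective := hD
  decomposition := by simp [start]
  order_eq := by simp [start]
  order_le := hm

/-- If `C i` were no component of the residual divisor, then Bezout's inequality would hold for
`C i` with the actual multiplicities, hence with the smaller orders. -/
theorem Violates.one_le_residual (hP : Function.Injective P) {σ : Stage K s r}
    (h0 : 0 ≤ σ.residual) (hle : ∀ j, σ.order j ≤ σ.residual.mult (P j)) {i : Fin r}
    (hi : σ.Violates P C i) : 1 ≤ σ.residual (C i) := by
  by_contra hlt
  have h1 : σ.residual (C i) = 0 := by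
    have := h0 (C i)
    simp only [Finsupp.coe_zero, Pi.zero_apply] at this
    omega
  refine absurd hi (not_lt.2 ((Finset.sum_le_sum fun j _ => ?_).trans (bezout_inequality hP h0 h1)))
  exact mul_le_mul_of_nonneg_right (hle j) (Int.natCast_nonneg _)

theorem IsAdmissible.step (hP : Function.Injective P) (hC : Function.Injective C)
    {D : PlaneDivisor K} {m : Fin s → ℤ} {σ τ : Stage K s r} (hσ : IsAdmissible P C D m σ)
    (h : Step P C σ τ) : IsAdmissible P C D m τ := by
  obtain ⟨S, -, hS, rfl⟩ := h
  have hS' := fun i hi => (hS i hi).one_le_residual hP hσ.effective hσ.order_le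
  refine ⟨fun E => ?_, ?_, fun j => ?_, fun j => ?_⟩
  · have hE0 := hσ.effective E
    simp only [remove, Finsupp.coe_sub, Pi.sub_apply, Finsupp.coe_zero, Pi.zero_apply] at hE0 ⊢
    by_cases hE : ∃ i, C i = E
    · obtain ⟨i, rfl⟩ := hE
      rw [sum_ofCurve_apply hC]
      split_ifs with hi
      · linarith [hS' i hi]
      · simpa using hE0
    · rw [sum_ofCurve_apply_of_ne S (not_exists.1 hE)]
      simpa using hE0
  · conv_lhs => rw [hσ.decomposition]
    simp [remove, add_smul, Finset.sum_add_distrib, ite_smul]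
  · simp only [remove, hσ.order_eq j, Nat.cast_add, add_mul, Finset.sum_add_distrib]
    simp [sub_sub]
  · simp only [remove, mult_sub, mult_finsetSum, mult_ofCurve]
    linarith [hσ.order_le j]

theorem IsAdmissible.reduces (hP : Function.Injective P) (hC : Function.Injective C)
    {D : PlaneDivisor K} {m : Fin s → ℤ} {σ τ : Stage K s r} (hσ : IsAdmissible P C D m σ)
    (h : Reduces P C σ τ) : IsAdmissible P C D m τ := by
  induction h with
  | refl => exact hσ
  | tail _ h ih => exact ih.step hP hC h

/-- The number of curves `C i`, with multiplicity, that are left in the residual divisor. -/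
def size (C : Fin r → PlaneCurve K) (σ : Stage K s r) : ℤ := ∑ i, σ.residual (C i)

theorem IsAdmissible.size_nonneg {D : PlaneDivisor K} {m : Fin s → ℤ} {σ : Stage K s r}
    (hσ : IsAdmissible P C D m σ) : 0 ≤ σ.size C :=
  Finset.sum_nonneg fun i _ => hσ.effective (C i)

theorem size_step (hC : Function.Injective C) {σ τ : Stage K s r} (h : Step P C σ τ) :
    τ.size C + 1 ≤ σ.size C := by
  obtain ⟨S, hS, -, rfl⟩ := h
  have : (1 : ℤ) ≤ S.card := by exact_mod_cast hS.card_pos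
  simp only [size, remove, Finsupp.coe_sub, Pi.sub_apply, sum_ofCurve_apply hC,
    Finset.sum_sub_distrib, Finset.sum_ite_mem, Finset.univ_inter, Finset.sum_const, nsmul_eq_mul,
    mul_one]
  linarith

/-- Removing other curves preserves a violation: by Bezout's inequality for pairs of distinct
curves, the intersection number drops at least as much as the sum of the orders. -/
theorem Violates.remove (hP : Function.Injective P) (hC : Function.Injective C) {σ : Stage K s r}
    {i : Fin r} (hi : σ.Violates P C i) {S : Finset (Fin r)} (hiS : i ∉ S) :
    (σ.remove P C S).Violates P C i := by
  have h : ∑ j, (∑ k ∈ S, ((C k).mult (P j) : ℤ)) * (C i).mult (P j) ≤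
      ∑ k ∈ S, ((C k).degree : ℤ) * (C i).degree := by
    simp only [Finset.sum_mul]
    rw [Finset.sum_comm]
    refine Finset.sum_le_sum fun k hk => ?_
    have hki : C k ≠ C i := hC.ne (ne_of_mem_of_not_mem hk hiS)
    exact_mod_cast PlaneCurve.bezout_inequality hP hki
  simp only [Violates, inter, Stage.remove, degree_sub, degree_finsetSum, degree_ofCurve, sub_mul,
    Finset.sum_sub_distrib, Finset.sum_mul] at hi h ⊢
  linarith

theorem remove_remove_sdiff (σ : Stage K s r) (S T : Finset (Fin r)) :
    (σ.remove P C S).remove P C (T \ S) = σ.remove P C (S ∪ T) := by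
  have hd : Disjoint S (T \ S) := Finset.disjoint_sdiff
  rw [← Finset.union_sdiff_self_eq_union]
  ext1
  · ext i
    have : i ∈ S → i ∉ T \ S := fun h => Finset.disjoint_left.1 hd h
    simp only [remove, Finset.mem_union]
    grind
  · simp only [remove, Finset.sum_union hd, sub_sub]
  · simp only [remove, Finset.sum_union hd, sub_sub]

theorem remove_empty (σ : Stage K s r) : σ.remove P C ∅ = σ := by
  ext1 <;> simp [remove]

theorem reflGen_step_remove (hP : Function.Injective P) (hC : Function.Injective C)
    {σ : Stage K s r} (S : Finset (Fin r)) {T : Finset (Fin r)} (hT : ∀ i ∈ T, σ.Violates P C i) :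
    Relation.ReflGen (Step P C) (σ.remove P C S) (σ.remove P C (S ∪ T)) := by
  rw [← remove_remove_sdiff]
  rcases (T \ S).eq_empty_or_nonempty with h | h
  · rw [h, remove_empty]
  · refine .single ⟨T \ S, h, fun i hi => ?_, rfl⟩
    rw [Finset.mem_sdiff] at hi
    exact (hT i hi.1).remove hP hC hi.2

/-- The diamond property: the steps that remove `S` and `T` both lead on to the stage in which
`S ∪ T` is removed. -/
theorem step_diamond (hP : Function.Injective P) (hC : Function.Injective C)
    {σ τ₁ τ₂ : Stage K s r} (h₁ : Step P C σ τ₁) (h₂ : Step P C σ τ₂) :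
    ∃ ρ, Relation.ReflGen (Step P C) τ₁ ρ ∧ Relation.ReflGen (Step P C) τ₂ ρ := by
  obtain ⟨S, -, hS, rfl⟩ := h₁
  obtain ⟨T, -, hT, rfl⟩ := h₂
  refine ⟨σ.remove P C (S ∪ T), reflGen_step_remove hP hC S hT, ?_⟩
  rw [Finset.union_comm]
  exact reflGen_step_remove hP hC T hS

theorem IsTerminal.eq_of_reduces {σ τ : Stage K s r} (hσ : σ.IsTerminal P C)
    (h : Reduces P C σ τ) : τ = σ := by
  rcases h.cases_head with rfl | ⟨ρ, ⟨S, ⟨i, hi⟩, hS, -⟩, -⟩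
  · rfl
  · exact absurd (hS i hi) (hσ i)

theorem reduces_confluent (hP : Function.Injective P) (hC : Function.Injective C)
    {σ τ₁ τ₂ : Stage K s r} (h₁ : Reduces P C σ τ₁) (h₂ : Reduces P C σ τ₂) :
    ∃ ρ, Reduces P C τ₁ ρ ∧ Reduces P C τ₂ ρ :=
  Relation.church_rosser (fun _ _ _ h h' =>
    (step_diamond hP hC h h').imp fun _ hρ => ⟨hρ.1, hρ.2.to_reflTransGen⟩) h₁ h₂

theorem eq_of_reduces_of_isTerminal (hP : Function.Injective P) (hC : Function.Injective C)
    {σ τ₁ τ₂ : Stage K s r} (h₁ : Reduces P C σ τ₁) (h₂ : Reduces P C σ τ₂)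
    (ht₁ : τ₁.IsTerminal P C) (ht₂ : τ₂.IsTerminal P C) : τ₁ = τ₂ := by
  obtain ⟨ρ, hρ₁, hρ₂⟩ := reduces_confluent hP hC h₁ h₂
  exact (ht₁.eq_of_reduces hρ₁).symm.trans (ht₂.eq_of_reduces hρ₂)

theorem round_eq_or_step (σ : Stage K s r) :
    σ.IsTerminal P C ∧ σ.round P C = σ ∨ Step P C σ (σ.round P C) := by
  classical
  have hmem : ∀ i, i ∈ σ.violating P C ↔ σ.Violates P C i := by simp [violating]
  rcases (σ.violating P C).eq_empty_or_nonempty with h | h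
  · refine .inl ⟨fun i hi => ?_, by rw [round, h, remove_empty]⟩
    rw [← hmem, h] at hi
    exact absurd hi (Finset.notMem_empty i)
  · exact .inr ⟨_, h, fun i hi => (hmem i).1 hi, rfl⟩

theorem reduces_iterate_round (σ : Stage K s r) (n : ℕ) :
    Reduces P C σ ((round P C)^[n] σ) := by
  induction n with
  | zero => exact .refl
  | succ n ih =>
    rw [Function.iterate_succ_apply']
    rcases round_eq_or_step (P := P) (C := C) ((round P C)^[n] σ) with h | h
    · rwa [h.2]
    · exact ih.tail h

theorem isTerminal_iterate_round_or (hC : Function.Injective C) (σ : Stage K s r) (n : ℕ) :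
    ((round P C)^[n] σ).IsTerminal P C ∨ ((round P C)^[n] σ).size C + n ≤ σ.size C := by
  induction n with
  | zero => simp
  | succ n ih =>
    rw [Function.iterate_succ_apply']
    rcases round_eq_or_step (P := P) (C := C) ((round P C)^[n] σ) with h | h
    · exact .inl (by rw [h.2]; exact h.1)
    · rcases ih with ih | ih
      · exact .inl (by rwa [ih.eq_of_reduces (.single h)])
      · have := size_step hC h
        push_cast
        exact .inr (by linarith)

theorem IsAdmissible.isTerminal_iterate_round (hP : Function.Injective P)
    (hC : Function.Injective C) {D : PlaneDivisor K} {m : Fin s → ℤ} {σ : Stage K s r}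
    (hσ : IsAdmissible P C D m σ) {n : ℕ} (hn : (σ.size C).toNat < n) :
    ((round P C)^[n] σ).IsTerminal P C := by
  refine (isTerminal_iterate_round_or hC σ n).resolve_right fun h => ?_
  have := (hσ.reduces hP hC (reduces_iterate_round σ n)).size_nonneg
  omega

theorem IsAdmissible.not_infinite (hP : Function.Injective P)
    (hC : Function.Injective C) {D : PlaneDivisor K} {m : Fin s → ℤ} {σ : Stage K s r}
    (hσ : IsAdmissible P C D m σ) :
    ¬ ∃ f : ℕ → Stage K s r, f 0 = σ ∧ ∀ n, Step P C (f n) (f (n + 1)) := by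
  rintro ⟨f, rfl, hf⟩
  have hadm : ∀ n, IsAdmissible P C D m (f n) := fun n => by
    induction n with
    | zero => exact hσ
    | succ n ih => exact ih.step hP hC (hf n)
  have hsize : ∀ n : ℕ, (f n).size C + n ≤ (f 0).size C := fun n => by
    induction n with
    | zero => simp
    | succ n ih =>
      have := size_step hC (hf n)
      push_cast
      linarith
  have h1 := hsize (((f 0).size C).toNat + 1)
  have h2 := (hadm (((f 0).size C).toNat + 1)).size_nonneg
  omega

end Stage

end BezoutDecomposition

end

theorem mainTheorem7 {K : Type*} [Field K] [IsAlgClosed K] [CharZero K] {s r : ℕ}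
    (P : Fin s → BezoutDecomposition.Plane K) (hP : Function.Injective P)
    (C : Fin r → BezoutDecomposition.PlaneCurve K) (hC : Function.Injective C)
    (D : BezoutDecomposition.PlaneDivisor K) (hD : 0 ≤ D)
    (m : Fin s → ℤ) (hm : ∀ j, m j ≤ D.mult (P j)) :
    -- the algorithm is well defined: the residual divisors stay effective, the stages are
    -- decompositions of `D`, and violating curves are components of the residual divisor
    (∀ σ : BezoutDecomposition.Stage K s r,
      BezoutDecomposition.Stage.Reduces P C (BezoutDecomposition.Stage.start D m) σ →
        0 ≤ σ.residual ∧
        D = ∑ i, σ.coeff i • BezoutDecomposition.PlaneDivisor.ofCurve (C i) + σ.residual ∧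
        (∀ j, σ.order j = m j - ∑ k, (σ.coeff k : ℤ) * ((C k).mult (P j) : ℤ)) ∧
        (∀ j, σ.order j ≤ σ.residual.mult (P j)) ∧
        (∀ i, σ.Violates P C i → 1 ≤ σ.residual (C i))) ∧
    -- termination: there is no infinite sequence of reductions
    (¬ ∃ f : ℕ → BezoutDecomposition.Stage K s r,
      f 0 = BezoutDecomposition.Stage.start D m ∧
        ∀ n, BezoutDecomposition.Stage.Step P C (f n) (f (n + 1))) ∧
    -- local confluence
    (∀ σ τ₁ τ₂ : BezoutDecomposition.Stage K s r,
      BezoutDecomposition.Stage.Reduces P C (BezoutDecomposition.Stage.start D m) σ →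
      BezoutDecomposition.Stage.Step P C σ τ₁ → BezoutDecomposition.Stage.Step P C σ τ₂ →
        ∃ ρ, BezoutDecomposition.Stage.Reduces P C τ₁ ρ ∧
          BezoutDecomposition.Stage.Reduces P C τ₂ ρ) ∧
    -- existence and uniqueness of the outcome, whatever the order of the reductions
    (∃ (a : Fin r → ℕ) (B : BezoutDecomposition.PlaneDivisor K),
      BezoutDecomposition.IsBezoutDecomposition P C D m a B ∧
      (∀ (a' : Fin r → ℕ) (B' : BezoutDecomposition.PlaneDivisor K),
        BezoutDecomposition.IsBezoutDecomposition P C D m a' B' → a' = a ∧ B' = B) ∧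
      D = ∑ i, a i • BezoutDecomposition.PlaneDivisor.ofCurve (C i) + B ∧
      0 ≤ B ∧
      (∀ i, ∑ j, (m j - ∑ k, (a k : ℤ) * ((C k).mult (P j) : ℤ)) * ((C i).mult (P j) : ℤ) ≤
        B.inter (BezoutDecomposition.PlaneDivisor.ofCurve (C i))) ∧
      -- every partial reduction can be completed, and ends in this decomposition
      (∀ σ : BezoutDecomposition.Stage K s r,
        BezoutDecomposition.Stage.Reduces P C (BezoutDecomposition.Stage.start D m) σ →
        ∃ τ : BezoutDecomposition.Stage K s r, BezoutDecomposition.Stage.Reduces P C σ τ ∧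
          τ.IsTerminal P C ∧ τ.coeff = a ∧ τ.residual = B) ∧
      -- so does the algorithm that subtracts all violating curves simultaneously in each round
      (∃ N : ℕ, ∀ n, N ≤ n →
        ((BezoutDecomposition.Stage.round P C)^[n]
          (BezoutDecomposition.Stage.start D m)).IsTerminal P C ∧
        ((BezoutDecomposition.Stage.round P C)^[n]
          (BezoutDecomposition.Stage.start D m)).coeff = a ∧
        ((BezoutDecomposition.Stage.round P C)^[n]
          (BezoutDecomposition.Stage.start D m)).residual = B)) := by
  have hstart := BezoutDecomposition.Stage.isAdmissible_start (C := C) hD hm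
  have hadm := fun (σ : BezoutDecomposition.Stage K s r) h => hstart.reduces (τ := σ) hP hC h
  refine ⟨fun σ hσ => ?_, hstart.not_infinite hP hC, fun σ τ₁ τ₂ _ h₁ h₂ => ?_, ?_⟩
  · have h := hadm σ hσ
    exact ⟨h.effective, h.decomposition, h.order_eq, h.order_le,
      fun i hi => hi.one_le_residual hP h.effective h.order_le⟩
  · exact BezoutDecomposition.Stage.reduces_confluent hP hC (.single h₁) (.single h₂)
  · set σ₀ : BezoutDecomposition.Stage K s r := BezoutDecomposition.Stage.start D m with hσ₀
    -- the algorithm with simultaneous subtraction stops after at most `N` rounds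
    set N := (σ₀.size C).toNat + 1 with hN
    set ω := (BezoutDecomposition.Stage.round P C)^[N] σ₀ with hω_def
    have hω : BezoutDecomposition.Stage.Reduces P C σ₀ ω :=
      BezoutDecomposition.Stage.reduces_iterate_round σ₀ N
    have hωt : ω.IsTerminal P C := hstart.isTerminal_iterate_round hP hC (Nat.lt_succ_self _)
    have huniq : ∀ τ, BezoutDecomposition.Stage.Reduces P C σ₀ τ → τ.IsTerminal P C → τ = ω :=
      fun τ hτ ht => BezoutDecomposition.Stage.eq_of_reduces_of_isTerminal hP hC hτ hω ht hωt
    have h := hadm ω hω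
    refine ⟨ω.coeff, ω.residual, ⟨ω, hω, hωt, rfl, rfl⟩, ?_, h.decomposition, h.effective,
      fun i => ?_, fun σ hσ => ?_, N, fun n hn => ?_⟩
    · rintro _ _ ⟨τ, hτ, ht, rfl, rfl⟩
      rw [huniq τ hτ ht]
      exact ⟨rfl, rfl⟩
    · simp only [← h.order_eq]
      exact not_lt.1 (hωt i)
    · have hτ := BezoutDecomposition.Stage.reduces_iterate_round (P := P) (C := C) σ
        ((σ.size C).toNat + 1)
      have ht := (hadm σ hσ).isTerminal_iterate_round hP hC (Nat.lt_succ_self _)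
      have he := huniq _ (hσ.trans hτ) ht
      exact ⟨_, hτ, ht, by rw [he], by rw [he]⟩
    · have ht := hstart.isTerminal_iterate_round hP hC (n := n) (by omega)
      have he := huniq _ (BezoutDecomposition.Stage.reduces_iterate_round σ₀ n) ht
      exact ⟨ht, by rw [he], by rw [he]⟩
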